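/- Let $\mathbb H$ be the quaternions and let $\mathbb H^{1,1}$ be the right vector space $\mathbb H^2$ of columns with the form $\langle X,Y\rangle=\overline{X_1}Y_1-\overline{X_2}Y_2$. Let $Sp(1,1)$ be the group of quaternionic $2\times2$ matrices $P$ with $\langle PX,PY\rangle=\langle X,Y\rangle$ for all $X,Y$. The quaternionic hyperbolic line $\mathbf H$ is the set of right lines $X\mathbb H$ ($X\neq0$) with $\langle X,X\rangle<0$, and its ideal boundary $\partial\mathbf H$ is the set of right lines $X\mathbb H$ ($X\ne 0$) with $\langle X,X\rangle=0$. A matrix $P\in Sp(1,1)$ acts on right lines by $X\mathbb H\mapsto (PX)\mathbb H$. It is called *elliptic* if it fixes a point of $\mathbf H$; *parabolic* if it has exactly one fixed point in $\mathbf H\cup\partial\mathbf H$ and this point lies on $\partial\mathbf H$; *loxodromic* if it has exactly two fixed points in $\mathbf H\cup\partial\mathbf H$ and both lie on $\partial\mathbf H$. **Theorem.** Let $P=\begin{bmatrix}a&b\\c&d\end{bmatrix}\in Sp(1,1)$ with $P\neq\pm I$, and put $$\tau=\mathrm{Re}(a+d),\qquad \rho=2+|c-\bar b|^2+4\,\mathrm{Re}(a)\,\mathrm{Re}(d).$$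 In the $(\tau,\rho)$-plane let $R_1$ be the bounded region $|\tau|\le 2$, $4|\tau|-2\le\rho\le\tau^2+2$ between the curves $\rho=4|\tau|-2$ and $\rho=\tau^2+2$ (which touch at $(\pm2,6)$), and let $R_2$ be the region $\rho\ge\tau^2+2$. Then: (a) $P$ is elliptic if and only if either $(\tau,\rho)\in R_1\setminus(R_1\cap R_2)$, or $(\tau,\rho)\in (R_1\cap R_2)\setminus\{(\pm2,6)\}$, $\mathrm{Re}(a)=\mathrm{Re}(d)$ and $c=\bar b$. (b) $P$ is parabolic if and only if either $(\tau,\rho)=(\pm2,6)$, or $(\tau,\rho)\in (R_1\cap R_2)\setminus\{(\pm2,6)\}$ and $\mathrm{Re}(a)\neq\mathrm{Re}(d)$ or $c\neq\bar b$. (c) $P$ is loxodromic if and only if $(\tau,\rho)\in R_2\setminus (R_1\cap R_2)$. -/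

import Mathlib

open scoped Quaternion LinearAlgebra.Projectivization

noncomputable section

namespace QuatHyp

/-- Column vectors of length two over the quaternions. Scalars act on the right, that is, through
the opposite ring: `MulOpposite.op q • X = X q`. -/
abbrev Vec : Type := Fin 2 → ℍ[ℝ]

/-- The diagonal matrix `diag(1, -1)`. -/
def J : Matrix (Fin 2) (Fin 2) ℍ[ℝ] := !![1, 0; 0, -1]

/-- The Hermitian form `⟨X, Y⟩ = X* J Y` of signature `(1, 1)`. -/
def form (X Y : Vec) : ℍ[ℝ] := star X ⬝ᵥ J.mulVec Y

theorem form_eq (X Y : Vec) : form X Y = star (X 0) * Y 0 - star (X 1) * Y 1 := by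
  simp [form, J, dotProduct, Matrix.mulVec, Fin.sum_univ_two, sub_eq_add_neg]

/-- The group `Sp(1,1)`: the quaternionic matrices that preserve the form. -/
def Sp11 : Set (Matrix (Fin 2) (Fin 2) ℍ[ℝ]) :=
  {P | ∀ X Y : Vec, form (P.mulVec X) (P.mulVec Y) = form X Y}

/-- `X ↦ P X`, as a map that is linear for the right quaternionic structure. -/
def toRightLin (P : Matrix (Fin 2) (Fin 2) ℍ[ℝ]) : Vec →ₗ[(ℍ[ℝ])ᵐᵒᵖ] Vec where
  toFun X := P.mulVec X
  map_add' X Y := P.mulVec_add X Y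
  map_smul' q X := P.mulVec_smul q X

theorem toRightLin_injective {P : Matrix (Fin 2) (Fin 2) ℍ[ℝ]} (hP : P ∈ Sp11) :
    Function.Injective (toRightLin P) := by
  rw [injective_iff_map_eq_zero]
  intro X hX
  have hX' : P.mulVec X = 0 := hX
  have key : ∀ Y : Vec, form X Y = 0 := by
    intro Y
    rw [← hP X Y, hX', form_eq]
    simp
  have h0 := key ![1, 0]
  have h1 := key ![0, 1]
  rw [form_eq] at h0 h1
  funext i
  fin_cases i
  · simpa using h0
  · simpa using h1

/-- The quaternionic projective line: the right one-dimensional subspaces `X ℍ`. -/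
abbrev ProjLine : Type := ℙ (ℍ[ℝ])ᵐᵒᵖ Vec

/-- The collineation `X ℍ ↦ (P X) ℍ` induced by `P`. -/
def collineation (P : Sp11) : ProjLine → ProjLine :=
  Projectivization.map (toRightLin P.1) (toRightLin_injective P.2)

/-- The quaternionic hyperbolic line (projective model): the points `X ℍ` with `⟨X, X⟩ < 0`.
The quaternion `⟨X, X⟩` is real, so it is compared with `0` through its real part. -/
def hypLine : Set ProjLine :=
  {x | ∃ (X : Vec) (hX : X ≠ 0),
    x = Projectivization.mk (ℍ[ℝ])ᵐᵒᵖ X hX ∧ (form X X).re < 0}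

/-- The ideal boundary: the points `X ℍ` with `⟨X, X⟩ = 0`. -/
def idealBoundary : Set ProjLine :=
  {x | ∃ (X : Vec) (hX : X ≠ 0),
    x = Projectivization.mk (ℍ[ℝ])ᵐᵒᵖ X hX ∧ form X X = 0}

/-- The fixed points of the collineation in the hyperbolic line and its ideal boundary. -/
def fixedPts (P : Sp11) : Set ProjLine :=
  {x | x ∈ hypLine ∪ idealBoundary ∧ collineation P x = x}

/-- There is a fixed point in the hyperbolic line. -/
def IsElliptic (P : Sp11) : Prop :=
  ∃ x ∈ hypLine, collineation P x = x

/-- There is exactly one fixed point, and it lies on the ideal boundary. -/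
def IsParabolic (P : Sp11) : Prop :=
  ∃ x ∈ idealBoundary, fixedPts P = {x}

/-- There are exactly two fixed points, and they lie on the ideal boundary. -/
def IsLoxodromic (P : Sp11) : Prop :=
  ∃ x ∈ idealBoundary, ∃ y ∈ idealBoundary, x ≠ y ∧ fixedPts P = {x, y}

/-- The bounded region between the curves `ρ = 4|τ| - 2` and `ρ = τ² + 2`. The curves touch at
`τ = ±2`, and the region is the part with `|τ| ≤ 2`. -/
def R₁ : Set (ℝ × ℝ) :=
  {p | |p.1| ≤ 2 ∧ 4 * |p.1| - 2 ≤ p.2 ∧ p.2 ≤ p.1 ^ 2 + 2}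

/-- The region on and above the parabola `ρ = τ² + 2`. -/
def R₂ : Set (ℝ × ℝ) := {p | p.1 ^ 2 + 2 ≤ p.2}

end QuatHyp

end

open scoped RightActions

noncomputable section

namespace QuatHyp

/-! ### The Hermitian form. -/

section Form

/-! Everything is read off S = P + P⁻¹ (`sym`), which is self-adjoint and commutes with P. Its
diagonal 2Re(a), 2Re(d) is real and its off-diagonal entries are g = c - b̄ and -ḡ, so S satisfies
the real quadratic S² - 2τS + (ρ - 2) = 0 (`sym_sym`). A quarter of the discriminant is D = τ² + 2 -
ρ = (Re a - Re d)² - |g|². If PX = Xr then SX = X(r + r⁻¹). Conversely, if SX = Xu with u = r + r⁻¹,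
then PX - Xr⁻¹ is zero or an eigenvector of P (`eigen_of_sym`). D > 0: S has two eigenlines, one
negative and one positive, both kept by P. P acts on them by unit quaternions, so the eigenvalues of
S lie in [-2, 2], which is the membership in R₁ (`isElliptic_of_pos`). D = 0, S not scalar: S - τ is
nilpotent, and its isotropic kernel is the only fixed point (`isParabolic_of_nilpotent`). D = 0, S =
τ: P² - τP + 1 = 0, and |τ| < 2, = 2, > 2 gives the elliptic, parabolic and loxodromic types. D < 0:
S has a nonreal eigenvalue, hence P has an eigenvalue of norm ≠ 1 (`isLoxodromic_of_neg`). The types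
exclude one another, so these implications give the equivalences. -/

theorem form_sub_right (X Y Z : Vec) : form X (Y - Z) = form X Y - form X Z := by
  simp only [form_eq, Pi.sub_apply]; noncomm_ring

theorem form_smul_right (X Y : Vec) (r : ℍ[ℝ]) : form X (Y <• r) = form X Y * r := by
  simp [form_eq, sub_mul, mul_assoc]

theorem form_smul_left (X Y : Vec) (r : ℍ[ℝ]) : form (X <• r) Y = star r * form X Y := by
  simp [form_eq, mul_sub, mul_assoc]

theorem form_add_left (X Y Z : Vec) : form (X + Y) Z = form X Z + form Y Z := by
  simp only [form_eq, Pi.add_apply, star_add]; noncomm_ring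

theorem form_self (X : Vec) : form X X = ((‖X 0‖ ^ 2 - ‖X 1‖ ^ 2 : ℝ) : ℍ[ℝ]) := by
  simp only [form_eq, Quaternion.star_mul_self, Quaternion.normSq_eq_norm_mul_self,
    Quaternion.coe_sub, sq]

theorem form_self_re (X : Vec) : (form X X).re = ‖X 0‖ ^ 2 - ‖X 1‖ ^ 2 := by
  rw [form_self, Quaternion.re_coe]

theorem form_self_eq_zero_iff (X : Vec) : form X X = 0 ↔ (form X X).re = 0 := by
  rw [form_self, Quaternion.re_coe, ← Quaternion.coe_zero, Quaternion.coe_inj]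

theorem form_smul_self_re (X : Vec) (r : ℍ[ℝ]) :
    (form (X <• r) (X <• r)).re = ‖r‖ ^ 2 * (form X X).re := by
  simp only [form_self_re, Pi.smul_apply, MulOpposite.smul_eq_mul_unop, MulOpposite.unop_op,
    norm_mul]
  ring

end Form

/-! ### The adjoint, eigenvalues and P + P⁻¹. -/

section Adjoint

/-- The adjoint `J P* J` of `P` for the Hermitian form. -/
def adj (P : Matrix (Fin 2) (Fin 2) ℍ[ℝ]) : Matrix (Fin 2) (Fin 2) ℍ[ℝ] :=
  !![star (P 0 0), -star (P 1 0); -star (P 0 1), star (P 1 1)]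

theorem form_mulVec_left (P : Matrix (Fin 2) (Fin 2) ℍ[ℝ]) (X Y : Vec) :
    form (P.mulVec X) Y = form X ((adj P).mulVec Y) := by
  simp [form_eq, adj, dotProduct, Fin.sum_univ_two]
  noncomm_ring

theorem ext_form {X Y : Vec} (h : ∀ Z, form Z X = form Z Y) : X = Y := by
  have h0 := h ![1, 0]
  have h1 := h ![0, 1]
  rw [form_eq, form_eq] at h0 h1
  funext i
  fin_cases i
  · simpa using h0
  · simpa using h1

variable {P : Matrix (Fin 2) (Fin 2) ℍ[ℝ]}

theorem adj_mul (hP : P ∈ Sp11) : adj P * P = 1 := by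
  apply Matrix.ext_of_mulVec_single
  intro i
  apply ext_form
  intro Z
  rw [← Matrix.mulVec_mulVec, ← form_mulVec_left, hP, Matrix.one_mulVec]

theorem mul_adj (hP : P ∈ Sp11) : P * adj P = 1 := mul_eq_one_comm.mp (adj_mul hP)

theorem adj_mulVec_eigen (hP : P ∈ Sp11) {X : Vec} {r : ℍ[ℝ]} (hr : r ≠ 0)
    (h : P.mulVec X = X <• r) : (adj P).mulVec X = X <• r⁻¹ := by
  have h1 : X = (adj P).mulVec X <• r := by
    rw [← Matrix.mulVec_smul, ← h, Matrix.mulVec_mulVec, adj_mul hP, Matrix.one_mulVec]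
  conv_rhs => rw [h1]
  rw [smul_smul, ← MulOpposite.op_mul, mul_inv_cancel₀ hr, MulOpposite.op_one, one_smul]

theorem mulVec_ne_zero (hP : P ∈ Sp11) {X : Vec} (hX : X ≠ 0) : P.mulVec X ≠ 0 :=
  fun h => hX (toRightLin_injective hP (by simpa [toRightLin] using h))

theorem eigenvalue_ne_zero (hP : P ∈ Sp11) {X : Vec} {r : ℍ[ℝ]} (hX : X ≠ 0)
    (h : P.mulVec X = X <• r) : r ≠ 0 := by
  rintro rfl
  exact mulVec_ne_zero hP hX (by simpa using h)

theorem norm_eigenvalue (hP : P ∈ Sp11) {X : Vec} {r : ℍ[ℝ]}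
    (h : P.mulVec X = X <• r) (hX : (form X X).re ≠ 0) : ‖r‖ = 1 := by
  have h1 := congrArg (·.re) (hP X X)
  simp only [h, form_smul_self_re] at h1
  have h2 : ‖r‖ ^ 2 = 1 := mul_right_cancel₀ hX (by rw [h1, one_mul])
  exact (pow_eq_one_iff_of_nonneg (norm_nonneg r) two_ne_zero).1 h2

theorem inv_eq_star {r : ℍ[ℝ]} (hr : ‖r‖ = 1) : r⁻¹ = star r := by
  have : r * star r = 1 := by
    rw [Quaternion.self_mul_star, Quaternion.normSq_eq_norm_mul_self, hr]; simp
  exact inv_eq_of_mul_eq_one_right this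

theorem add_inv_eq_re {r : ℍ[ℝ]} (hr : ‖r‖ = 1) : r + r⁻¹ = ((2 * r.re : ℝ) : ℍ[ℝ]) := by
  rw [inv_eq_star hr, Quaternion.self_add_star']

theorem abs_re_le (r : ℍ[ℝ]) : |r.re| ≤ ‖r‖ := by
  apply abs_le_of_sq_le_sq _ (norm_nonneg r)
  rw [sq ‖r‖, ← Quaternion.normSq_eq_norm_mul_self, Quaternion.normSq_def']
  nlinarith [sq_nonneg r.imI, sq_nonneg r.imJ, sq_nonneg r.imK]

/-- The self-adjoint matrix `P + P⁻¹`. -/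
def sym (P : Matrix (Fin 2) (Fin 2) ℍ[ℝ]) : Matrix (Fin 2) (Fin 2) ℍ[ℝ] := P + adj P

theorem form_sym (P : Matrix (Fin 2) (Fin 2) ℍ[ℝ]) (X Y : Vec) :
    form ((sym P).mulVec X) Y = form X ((sym P).mulVec Y) := by
  have : adj (sym P) = sym P := by
    ext1 i j; fin_cases i <;> fin_cases j <;> simp [sym, adj, add_comm]
  rw [form_mulVec_left, this]

theorem sym_comm (hP : P ∈ Sp11) (X : Vec) :
    (sym P).mulVec (P.mulVec X) = P.mulVec ((sym P).mulVec X) := by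
  rw [Matrix.mulVec_mulVec, Matrix.mulVec_mulVec, sym, mul_add, add_mul, adj_mul hP, mul_adj hP]

theorem sym_mulVec_eigen (hP : P ∈ Sp11) {X : Vec} {r : ℍ[ℝ]} (hr : r ≠ 0)
    (h : P.mulVec X = X <• r) : (sym P).mulVec X = X <• (r + r⁻¹) := by
  rw [sym, Matrix.add_mulVec, h, adj_mulVec_eigen hP hr h, MulOpposite.op_add, add_smul]

/-- Comes from P S = P² + 1. -/
theorem mulVec_mulVec_of_sym (hP : P ∈ Sp11) {X : Vec} {u : ℍ[ℝ]}
    (h : (sym P).mulVec X = X <• u) : P.mulVec (P.mulVec X) = P.mulVec X <• u - X := by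
  rw [← Matrix.mulVec_smul, ← h, sym, Matrix.add_mulVec, Matrix.mulVec_add,
    Matrix.mulVec_mulVec X P (adj P),
    mul_adj hP, Matrix.one_mulVec, add_sub_cancel_right]

/-- A unit q has q + q⁻¹ = 2 Re q. This is the source of the bounds on τ and ρ. -/
theorem abs_le_two_of_sym_eigen (hP : P ∈ Sp11) {X : Vec} {q : ℍ[ℝ]} {u : ℝ}
    (h : P.mulVec X = X <• q) (hX : X ≠ 0) (hq : ‖q‖ = 1)
    (hu : (sym P).mulVec X = X <• (u : ℍ[ℝ])) : |u| ≤ 2 := by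
  have hr := eigenvalue_ne_zero hP hX h
  rw [sym_mulVec_eigen hP hr h, add_inv_eq_re hq] at hu
  have h1 : ((2 * q.re : ℝ) : ℍ[ℝ]) = u := MulOpposite.op_injective (smul_left_injective _ hX hu)
  rw [← Quaternion.coe_injective h1, abs_mul, abs_two]
  linarith [abs_re_le q]

end Adjoint

/-! ### Fixed points as eigenlines; exclusivity of the types. -/

section Projective

theorem ne_zero_of_form_neg {X : Vec} (h : (form X X).re < 0) : X ≠ 0 := by
  rintro rfl
  simp [form_self_re] at h

theorem mk_mem_hypLine {X : Vec} (hX : X ≠ 0) :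
    Projectivization.mk (ℍ[ℝ])ᵐᵒᵖ X hX ∈ hypLine ↔ (form X X).re < 0 := by
  refine ⟨?_, fun h => ⟨X, hX, rfl, h⟩⟩
  rintro ⟨Y, hY, hXY, h⟩
  obtain ⟨r, rfl⟩ := (Projectivization.mk_eq_mk_iff' _ _ _ _ _).1 hXY
  induction r using MulOpposite.rec' with | _ r
  rw [form_smul_self_re]
  have : r ≠ 0 := by rintro rfl; simp at hX
  have := norm_pos_iff.2 this
  exact mul_neg_of_pos_of_neg (by positivity) h

theorem mk_mem_idealBoundary {X : Vec} (hX : X ≠ 0) :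
    Projectivization.mk (ℍ[ℝ])ᵐᵒᵖ X hX ∈ idealBoundary ↔ form X X = 0 := by
  refine ⟨?_, fun h => ⟨X, hX, rfl, h⟩⟩
  rintro ⟨Y, hY, hXY, h⟩
  obtain ⟨r, rfl⟩ := (Projectivization.mk_eq_mk_iff' _ _ _ _ _).1 hXY
  induction r using MulOpposite.rec' with | _ r
  rw [form_smul_left, form_smul_right, h, zero_mul, mul_zero]

theorem not_mem_idealBoundary_of_mem_hypLine {x : ProjLine} (h : x ∈ hypLine) :
    x ∉ idealBoundary := by
  induction x using Projectivization.ind with | _ X hX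
  rw [mk_mem_hypLine] at h
  rw [mk_mem_idealBoundary, form_self_eq_zero_iff]
  exact h.ne

theorem collineation_mk_eq_iff (P : Sp11) {X : Vec} (hX : X ≠ 0) :
    collineation P (Projectivization.mk (ℍ[ℝ])ᵐᵒᵖ X hX) = Projectivization.mk (ℍ[ℝ])ᵐᵒᵖ X hX ↔
      ∃ r : ℍ[ℝ], P.1.mulVec X = X <• r := by
  rw [collineation, Projectivization.map_mk, Projectivization.mk_eq_mk_iff']
  refine ⟨fun ⟨r, hr⟩ => ⟨r.unop, hr.symm⟩, fun ⟨r, hr⟩ => ⟨MulOpposite.op r, hr.symm⟩⟩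

theorem isElliptic_of_eigen (P : Sp11) {X : Vec} (h : (form X X).re < 0) {r : ℍ[ℝ]}
    (hr : P.1.mulVec X = X <• r) : IsElliptic P :=
  ⟨_, (mk_mem_hypLine (ne_zero_of_form_neg h)).2 h, (collineation_mk_eq_iff P _).2 ⟨r, hr⟩⟩

theorem isParabolic_of_eigen (P : Sp11) {X : Vec} (hX : X ≠ 0) (h : form X X = 0) {r : ℍ[ℝ]}
    (hr : P.1.mulVec X = X <• r)
    (huniq : ∀ (Y : Vec) (s : ℍ[ℝ]), Y ≠ 0 → P.1.mulVec Y = Y <• s → ∃ t : ℍ[ℝ], Y = X <• t) :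
    IsParabolic P := by
  refine ⟨Projectivization.mk _ X hX, (mk_mem_idealBoundary hX).2 h, Set.ext fun x => ?_⟩
  constructor
  · rintro ⟨-, hx⟩
    induction x using Projectivization.ind with | _ Y hY
    obtain ⟨s, hs⟩ := (collineation_mk_eq_iff P _).1 hx
    obtain ⟨t, ht⟩ := huniq Y s hY hs
    exact (Projectivization.mk_eq_mk_iff' _ _ _ _ _).2 ⟨_, ht.symm⟩
  · rintro rfl
    exact ⟨Or.inr ((mk_mem_idealBoundary hX).2 h), (collineation_mk_eq_iff P _).2 ⟨r, hr⟩⟩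

theorem form_self_eq_zero_of_eigen {P : Matrix (Fin 2) (Fin 2) ℍ[ℝ]} (hP : P ∈ Sp11) {X : Vec}
    {r : ℍ[ℝ]} (h : P.mulVec X = X <• r) (hr : ‖r‖ ≠ 1) : form X X = 0 := by
  rw [form_self_eq_zero_iff]
  by_contra h0
  exact hr (norm_eigenvalue hP h h0)

theorem exists_combination {X Y : Vec} (hX : X ≠ 0) (hXY : ∀ t : ℍ[ℝ], Y ≠ X <• t) (Z : Vec) :
    ∃ p q : ℍ[ℝ], Z = X <• p + Y <• q := by
  have hli : LinearIndependent (ℍ[ℝ])ᵐᵒᵖ ![X, Y] := by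
    rw [LinearIndependent.pair_iff' hX]
    intro a h
    exact hXY a.unop h.symm
  have hfr : Module.finrank (ℍ[ℝ])ᵐᵒᵖ Vec = 2 := by
    have e : (Fin 2 → (ℍ[ℝ])ᵐᵒᵖ) ≃ₗ[(ℍ[ℝ])ᵐᵒᵖ] Vec :=
      LinearEquiv.piCongrRight fun _ =>
        { MulOpposite.opAddEquiv.symm with map_smul' := fun r x => by simp }
    rw [← e.finrank_eq]; simp
  have hsp := hli.span_eq_top_of_card_eq_finrank (by simp [hfr])
  have hZ : Z ∈ Submodule.span (ℍ[ℝ])ᵐᵒᵖ (Set.range ![X, Y]) := hsp ▸ Submodule.mem_top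
  rw [Matrix.range_cons_cons_empty, Submodule.mem_span_pair] at hZ
  obtain ⟨p, q, h⟩ := hZ
  exact ⟨p.unop, q.unop, h.symm⟩

theorem isLoxodromic_of_eigen (P : Sp11) {X Y : Vec} (hX : X ≠ 0) (hY : Y ≠ 0) {r : ℍ[ℝ]}
    (hr : P.1.mulVec X = X <• r) (hr' : P.1.mulVec Y = Y <• r⁻¹) (h1 : ‖r‖ ≠ 1) :
    IsLoxodromic P := by
  have hr0 : r ≠ 0 := eigenvalue_ne_zero P.2 hX hr
  have h1' : ‖r⁻¹‖ ≠ 1 := by rwa [norm_inv, ne_eq, inv_eq_one]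
  have hne : ‖r‖ ≠ ‖r⁻¹‖ := by
    rw [norm_inv]
    intro h
    rw [← mul_eq_one_iff_eq_inv₀ (norm_ne_zero_iff.2 hr0), ← sq] at h
    exact h1 ((pow_eq_one_iff_of_nonneg (norm_nonneg r) two_ne_zero).1 h)
  have hXY : ∀ t : ℍ[ℝ], Y ≠ X <• t := by
    rintro t rfl
    rw [Matrix.mulVec_smul, hr, smul_smul, smul_smul, ← MulOpposite.op_mul,
      ← MulOpposite.op_mul] at hr'
    have h2 : r * t = t * r⁻¹ := MulOpposite.op_injective (smul_left_injective _ hX hr')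
    have ht : t ≠ 0 := by rintro rfl; simp at hY
    have h3 := congrArg norm h2
    rw [norm_mul, norm_mul, mul_comm] at h3
    exact hne (mul_left_cancel₀ (norm_ne_zero_iff.2 ht) h3)
  have hXb := (mk_mem_idealBoundary hX).2 (form_self_eq_zero_of_eigen P.2 hr h1)
  have hYb := (mk_mem_idealBoundary hY).2 (form_self_eq_zero_of_eigen P.2 hr' h1')
  refine ⟨_, hXb, _, hYb, ?_, Set.ext fun x => ?_⟩
  · intro h
    obtain ⟨t, ht⟩ := (Projectivization.mk_eq_mk_iff' _ _ _ _ _).1 h.symm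
    exact hXY t.unop ht.symm
  constructor
  · rintro ⟨-, hx⟩
    induction x using Projectivization.ind with | _ Z hZ
    obtain ⟨s, hs⟩ := (collineation_mk_eq_iff P _).1 hx
    obtain ⟨p, q, rfl⟩ := exists_combination hX hXY Z
    have hli : LinearIndependent (ℍ[ℝ])ᵐᵒᵖ ![X, Y] := by
      rw [LinearIndependent.pair_iff' hX]
      exact fun a h => hXY a.unop h.symm
    rw [Matrix.mulVec_add, Matrix.mulVec_smul, Matrix.mulVec_smul, hr, hr', smul_add, smul_smul,
      smul_smul, smul_smul, smul_smul] at hs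
    obtain ⟨hp, hq⟩ := hli.eq_of_pair hs
    have hp : r * p = p * s := MulOpposite.op_injective hp
    have hq : r⁻¹ * q = q * s := MulOpposite.op_injective hq
    have hpn := congrArg norm hp
    have hqn := congrArg norm hq
    rw [norm_mul, norm_mul, mul_comm] at hpn hqn
    by_cases hp0 : p = 0
    · right
      exact (Projectivization.mk_eq_mk_iff' _ _ _ _ _).2 ⟨_, by simp [hp0]; rfl⟩
    by_cases hq0 : q = 0
    · left
      exact (Projectivization.mk_eq_mk_iff' _ _ _ _ _).2 ⟨_, by simp [hq0]; rfl⟩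
    -- A third eigenline would have both coefficients nonzero, making s conjugate to both r and r⁻¹,
    -- whose norms differ.
    exact absurd ((mul_left_cancel₀ (norm_ne_zero_iff.2 hp0) hpn).trans
      (mul_left_cancel₀ (norm_ne_zero_iff.2 hq0) hqn).symm) hne
  · rintro (rfl | rfl)
    · exact ⟨Or.inr hXb, (collineation_mk_eq_iff P _).2 ⟨_, hr⟩⟩
    · exact ⟨Or.inr hYb, (collineation_mk_eq_iff P _).2 ⟨_, hr'⟩⟩

theorem IsElliptic.not_isParabolic {P : Sp11} (h : IsElliptic P) : ¬ IsParabolic P := by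
  rintro ⟨y, hy, hf⟩
  obtain ⟨x, hx, hfx⟩ := h
  have : x ∈ fixedPts P := ⟨Or.inl hx, hfx⟩
  rw [hf, Set.mem_singleton_iff] at this
  exact not_mem_idealBoundary_of_mem_hypLine hx (this ▸ hy)

theorem IsElliptic.not_isLoxodromic {P : Sp11} (h : IsElliptic P) : ¬ IsLoxodromic P := by
  rintro ⟨y, hy, z, hz, -, hf⟩
  obtain ⟨x, hx, hfx⟩ := h
  have : x ∈ fixedPts P := ⟨Or.inl hx, hfx⟩
  rw [hf] at this
  rcases this with rfl | rfl
  · exact not_mem_idealBoundary_of_mem_hypLine hx hy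
  · exact not_mem_idealBoundary_of_mem_hypLine hx hz

theorem IsParabolic.not_isLoxodromic {P : Sp11} (h : IsParabolic P) : ¬ IsLoxodromic P := by
  rintro ⟨y, -, z, -, hyz, hf⟩
  obtain ⟨x, -, hx⟩ := h
  rw [hx] at hf
  have h1 : y ∈ ({x} : Set ProjLine) := hf ▸ Or.inl rfl
  have h2 : z ∈ ({x} : Set ProjLine) := hf ▸ Or.inr rfl
  exact hyz (h1.trans h2.symm)

end Projective

/-! ### From eigenvectors of P + P⁻¹ to eigenvectors of P. -/

section Eigenvectors

variable {P : Matrix (Fin 2) (Fin 2) ℍ[ℝ]}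

theorem vec_ext {X Y : Vec} (h0 : X 0 = Y 0) (h1 : X 1 = Y 1) : X = Y := by
  funext i; fin_cases i
  · exact h0
  · exact h1

theorem smul_vec_eq (X : Vec) (r : ℍ[ℝ]) : X <• r = ![X 0 * r, X 1 * r] :=
  vec_ext rfl rfl

theorem mulVec_vec (a b c d : ℍ[ℝ]) (X : Vec) :
    (!![a, b; c, d]).mulVec X = ![a * X 0 + b * X 1, c * X 0 + d * X 1] := by
  apply vec_ext <;> simp [Matrix.vecHead, Matrix.vecTail]

theorem mulVec_eq_smul_iff (a b c d : ℍ[ℝ]) (X : Vec) (r : ℍ[ℝ]) :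
    (!![a, b; c, d]).mulVec X = X <• r ↔
      a * X 0 + b * X 1 = X 0 * r ∧ c * X 0 + d * X 1 = X 1 * r := by
  rw [mulVec_vec, smul_vec_eq]
  constructor
  · intro h
    exact ⟨congrFun h 0, congrFun h 1⟩
  · rintro ⟨h, h'⟩
    rw [h, h']

theorem smul_injective_right {X : Vec} (hX : X ≠ 0) {r s : ℍ[ℝ]} (h : X <• r = X <• s) : r = s :=
  MulOpposite.op_injective (smul_left_injective _ hX h)

theorem smul_smul_right (X : Vec) (r s : ℍ[ℝ]) : X <• r <• s = X <• (r * s) := by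
  rw [smul_smul, ← MulOpposite.op_mul]

/-- Factorization (P - r)(P - r⁻¹) = 0 on vectors with SY = Yu; the scalars act on the right and r
commutes with r⁻¹. -/
theorem eigen_of_sym (hP : P ∈ Sp11) {Y : Vec} {r u : ℍ[ℝ]} (hr0 : r ≠ 0) (hr : r + r⁻¹ = u)
    (h : (sym P).mulVec Y = Y <• u) :
    P.mulVec (P.mulVec Y - Y <• r⁻¹) = (P.mulVec Y - Y <• r⁻¹) <• r := by
  rw [Matrix.mulVec_sub, mulVec_mulVec_of_sym hP h, Matrix.mulVec_smul, smul_sub,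
    smul_smul_right, inv_mul_cancel₀ hr0, ← hr, MulOpposite.op_add, add_smul, MulOpposite.op_one,
    one_smul]
  abel

/-- For nonreal u the solutions of SX = Xu need not be stable under right scalars, so nondegeneracy
of the form on them is a separate hypothesis. It yields the second eigenline: if PX = Xs and PY =
Ys, then ⟨X, Y⟩ = s̄⟨X, Y⟩s, impossible when ⟨X, Y⟩ ≠ 0 and |s| ≠ 1. Hence PY - Ys is an eigenvector
for s⁻¹. -/
theorem isLoxodromic_of_nondegenerate (hP : P ∈ Sp11) {r u : ℍ[ℝ]} (hr0 : r ≠ 0)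
    (hr : r + r⁻¹ = u) (h1 : ‖r‖ ≠ 1) (hne : ∃ X ≠ 0, (sym P).mulVec X = X <• u)
    (hnd : ∀ X ≠ 0, (sym P).mulVec X = X <• u →
      ∃ Y, (sym P).mulVec Y = Y <• u ∧ form X Y ≠ 0) : IsLoxodromic ⟨P, hP⟩ := by
  have key : ∀ s : ℍ[ℝ], s ≠ 0 → s + s⁻¹ = u → ‖s‖ ≠ 1 → ∀ X ≠ 0, P.mulVec X = X <• s →
      IsLoxodromic ⟨P, hP⟩ := by
    intro s hs0 hs hs1 X hX hXs
    obtain ⟨Y, hY, hXY⟩ := hnd X hX (hs ▸ sym_mulVec_eigen hP hs0 hXs)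
    have hY' := eigen_of_sym hP (inv_ne_zero hs0) (by rw [inv_inv, add_comm, hs]) hY
    rw [inv_inv] at hY'
    refine isLoxodromic_of_eigen ⟨P, hP⟩ hX ?_ hXs hY' hs1
    intro h
    have h2 := congrArg norm (hP X Y)
    rw [hXs, sub_eq_zero.1 h, form_smul_left, form_smul_right, norm_mul, norm_mul, norm_star,
      mul_comm, mul_assoc] at h2
    have h3 : ‖s‖ ^ 2 = 1 := by
      have := norm_pos_iff.2 hXY
      apply mul_left_cancel₀ this.ne'
      rw [mul_one, sq, h2]
    exact hs1 ((pow_eq_one_iff_of_nonneg (norm_nonneg s) two_ne_zero).1 h3)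
  obtain ⟨X, hX, hXu⟩ := hne
  by_cases h : P.mulVec X - X <• r⁻¹ = 0
  · refine key r⁻¹ (inv_ne_zero hr0) (by rw [inv_inv, add_comm, hr]) ?_ X hX (sub_eq_zero.1 h)
    rwa [norm_inv, ne_eq, inv_eq_one]
  · exact key r hr0 hr h1 _ h (eigen_of_sym hP hr0 hr hXu)

/-- The quaternion `x + y i`. -/
def ofReIm (x y : ℝ) : ℍ[ℝ] := ⟨x, y, 0, 0⟩

@[simp] theorem re_ofReIm (x y : ℝ) : (ofReIm x y).re = x := rfl

@[simp] theorem imI_ofReIm (x y : ℝ) : (ofReIm x y).imI = y := rfl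

@[simp] theorem imJ_ofReIm (x y : ℝ) : (ofReIm x y).imJ = 0 := rfl

@[simp] theorem imK_ofReIm (x y : ℝ) : (ofReIm x y).imK = 0 := rfl

/-- A complex root of z² - (τ + σi)z + 1 works: norm 1 would force z + z⁻¹ to be real and in [-2,
2]. -/
theorem exists_add_inv_eq (τ σ : ℝ) (h : σ ≠ 0 ∨ 2 < |τ|) :
    ∃ r : ℍ[ℝ], r ≠ 0 ∧ r + r⁻¹ = ofReIm τ σ ∧ ‖r‖ ≠ 1 := by
  obtain ⟨z, hz⟩ : ∃ z : ℂ, z ^ 2 - ⟨τ, σ⟩ * z + 1 = 0 := by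
    obtain ⟨s, hs⟩ := IsAlgClosed.exists_pow_nat_eq ((⟨τ, σ⟩ : ℂ) ^ 2 - 4) (n := 2) (by norm_num)
    exact ⟨((⟨τ, σ⟩ : ℂ) + s) / 2, by linear_combination hs / 4⟩
  have hz0 : z ≠ 0 := by rintro rfl; simp at hz
  have hz' : z + z⁻¹ = ⟨τ, σ⟩ := by
    field_simp
    linear_combination hz
  have hr0 : Quaternion.ofComplex z ≠ 0 := by
    rwa [ne_eq, map_eq_zero]
  have hr : Quaternion.ofComplex z + (Quaternion.ofComplex z)⁻¹ = ofReIm τ σ := by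
    rw [← map_inv₀, ← map_add, hz']
    rfl
  refine ⟨Quaternion.ofComplex z, hr0, hr, fun h1 => ?_⟩
  rw [add_inv_eq_re h1] at hr
  have hre := congrArg (·.re) hr
  have him := congrArg (·.imI) hr
  simp only [Quaternion.re_coe, Quaternion.imI_coe, re_ofReIm, imI_ofReIm] at hre him
  rcases h with h | h
  · exact h him.symm
  · rw [← hre, abs_mul, abs_two] at h
    linarith [abs_re_le (Quaternion.ofComplex z)]

theorem exists_form_eq {X : Vec} (hX : X ≠ 0) (w : ℍ[ℝ]) : ∃ Z, form X Z = w := by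
  by_cases h0 : X 0 = 0
  · have h1 : X 1 ≠ 0 := fun h1 => hX (vec_ext h0 h1)
    refine ⟨![0, -((star (X 1))⁻¹ * w)], ?_⟩
    rw [form_eq]
    simp [mul_inv_cancel_left₀ (star_ne_zero.2 h1)]
  · refine ⟨![(star (X 0))⁻¹ * w, 0], ?_⟩
    rw [form_eq]
    simp [mul_inv_cancel_left₀ (star_ne_zero.2 h0)]

end Eigenvectors

/-! ### P + P⁻¹ in terms of the entries. -/

section Entries

variable {a b c d : ℍ[ℝ]}

theorem norm_sq_sub_of_mem (hP : !![a, b; c, d] ∈ Sp11) :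
    ‖a‖ ^ 2 - ‖c‖ ^ 2 = 1 ∧ ‖d‖ ^ 2 - ‖b‖ ^ 2 = 1 := by
  have h0 := congrArg (·.re) (hP ![1, 0] ![1, 0])
  have h1 := congrArg (·.re) (hP ![0, 1] ![0, 1])
  simp only [form_self_re, mulVec_vec] at h0 h1
  simp at h0 h1
  exact ⟨h0, by linarith⟩

theorem sym_eq (a b c d : ℍ[ℝ]) :
    sym !![a, b; c, d] = !![((2 * a.re : ℝ) : ℍ[ℝ]), -star (c - star b);
      c - star b, ((2 * d.re : ℝ) : ℍ[ℝ])] := by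
  rw [← Quaternion.self_add_star', ← Quaternion.self_add_star']
  ext1 i j
  fin_cases i <;> fin_cases j <;> simp [sym, adj, sub_eq_add_neg, add_comm]

theorem mul_star_eq (q : ℍ[ℝ]) : q * star q = ((‖q‖ ^ 2 : ℝ) : ℍ[ℝ]) := by
  rw [Quaternion.self_mul_star, Quaternion.normSq_eq_norm_mul_self, sq]

theorem star_mul_eq (q : ℍ[ℝ]) : star q * q = ((‖q‖ ^ 2 : ℝ) : ℍ[ℝ]) := by
  rw [Quaternion.star_mul_self, Quaternion.normSq_eq_norm_mul_self, sq]

theorem sym_sym (a b c d : ℍ[ℝ]) (Z : Vec) :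
    (sym !![a, b; c, d]).mulVec ((sym !![a, b; c, d]).mulVec Z) =
      (sym !![a, b; c, d]).mulVec Z <• ((2 * (a.re + d.re) : ℝ) : ℍ[ℝ]) -
        Z <• ((4 * a.re * d.re + ‖c - star b‖ ^ 2 : ℝ) : ℍ[ℝ]) := by
  rw [sym_eq]
  have h1 := mul_star_eq (c - star b)
  have h2 := star_mul_eq (c - star b)
  set g := c - star b
  have ha := fun x : ℍ[ℝ] => Quaternion.coe_commutes (2 * a.re) x
  have hd := fun x : ℍ[ℝ] => Quaternion.coe_commutes (2 * d.re) x
  have hn := fun x : ℍ[ℝ] => Quaternion.coe_commutes (‖g‖ ^ 2) x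
  have e1 : ((2 * (a.re + d.re) : ℝ) : ℍ[ℝ]) = (2 * a.re : ℝ) + (2 * d.re : ℝ) := by
    rw [← Quaternion.coe_add]; ring_nf
  have e2 : ((4 * a.re * d.re + ‖g‖ ^ 2 : ℝ) : ℍ[ℝ]) =
      (2 * a.re : ℝ) * (2 * d.re : ℝ) + (‖g‖ ^ 2 : ℝ) := by
    rw [← Quaternion.coe_mul, ← Quaternion.coe_add]; ring_nf
  rw [mulVec_vec, mulVec_vec, smul_vec_eq, smul_vec_eq, e1, e2]
  set A := ((2 * a.re : ℝ) : ℍ[ℝ])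
  set D := ((2 * d.re : ℝ) : ℍ[ℝ])
  set G := ((‖g‖ ^ 2 : ℝ) : ℍ[ℝ])
  apply vec_ext
  · simp only [Matrix.cons_val_zero, Matrix.cons_val_one, Pi.sub_apply]
    linear_combination (norm := noncomm_ring) ha (A * Z 0 - star g * Z 1) - h2 * Z 0 -
      hn (Z 0) + hd (A * Z 0 - star g * Z 1) - D * ha (Z 0) - hd (Z 0 * A) +
      hd (star g) * Z 1
  · simp only [Matrix.cons_val_zero, Matrix.cons_val_one, Pi.sub_apply]
    linear_combination (norm := noncomm_ring) ha (g * Z 0) + hd (g * Z 0) - h1 * Z 1 -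
      hn (Z 1) + ha (D * Z 1) + hd (D * Z 1) - A * hd (Z 1) - ha (Z 1 * D) -
      ha g * Z 0 + Z 1 * ha D

theorem sym_mulVec_smul_eq_iff (X : Vec) (u : ℝ) :
    (sym !![a, b; c, d]).mulVec X = X <• (u : ℍ[ℝ]) ↔
      ((2 * a.re - u : ℝ) : ℍ[ℝ]) * X 0 = star (c - star b) * X 1 ∧
      (c - star b) * X 0 = ((u - 2 * d.re : ℝ) : ℍ[ℝ]) * X 1 := by
  rw [sym_eq, mulVec_eq_smul_iff, ← Quaternion.coe_commutes, ← Quaternion.coe_commutes,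
    Quaternion.coe_sub, Quaternion.coe_sub]
  constructor <;> rintro ⟨h1, h2⟩ <;> constructor
  · linear_combination (norm := noncomm_ring) h1
  · linear_combination (norm := noncomm_ring) h2
  · linear_combination (norm := noncomm_ring) h1
  · linear_combination (norm := noncomm_ring) h2

/-- One row of the eigenvector equation already confines the solutions to a line. As P commutes with
S, it preserves that line. -/
theorem sym_kernel_left {t : ℝ} (ht : t ≠ 0) {Z : Vec}
    (h : (sym !![a, b; c, d]).mulVec Z = Z <• ((2 * a.re - t : ℝ) : ℍ[ℝ])) :
    ∃ q : ℍ[ℝ], Z = ![star (c - star b), (t : ℍ[ℝ])] <• q := by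
  obtain ⟨h, -⟩ := (sym_mulVec_smul_eq_iff _ _).1 h
  rw [sub_sub_cancel] at h
  have ht' : (t : ℍ[ℝ]) ≠ 0 := by rwa [← Quaternion.coe_zero, ne_eq, Quaternion.coe_inj]
  refine ⟨(t : ℍ[ℝ])⁻¹ * Z 1, ?_⟩
  rw [smul_vec_eq]
  apply vec_ext
  · simp only [Matrix.cons_val_zero]
    apply mul_left_cancel₀ ht'
    rw [h, ← mul_assoc, Quaternion.coe_commutes, mul_assoc, mul_inv_cancel_left₀ ht']
  · simp [mul_inv_cancel_left₀ ht']

theorem sym_kernel_right {t : ℝ} (ht : t ≠ 0) {Z : Vec}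
    (h : (sym !![a, b; c, d]).mulVec Z = Z <• ((2 * d.re + t : ℝ) : ℍ[ℝ])) :
    ∃ q : ℍ[ℝ], Z = ![(t : ℍ[ℝ]), c - star b] <• q := by
  obtain ⟨-, h⟩ := (sym_mulVec_smul_eq_iff _ _).1 h
  rw [add_sub_cancel_left] at h
  have ht' : (t : ℍ[ℝ]) ≠ 0 := by rwa [← Quaternion.coe_zero, ne_eq, Quaternion.coe_inj]
  refine ⟨(t : ℍ[ℝ])⁻¹ * Z 0, ?_⟩
  rw [smul_vec_eq]
  apply vec_ext
  · simp [mul_inv_cancel_left₀ ht']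
  · simp only [Matrix.cons_val_zero, Matrix.cons_val_one]
    apply mul_left_cancel₀ ht'
    rw [← h, ← mul_assoc (t : ℍ[ℝ]), Quaternion.coe_commutes, mul_assoc, mul_inv_cancel_left₀ ht']

/-- The quadratic is the one satisfied by S after substituting 2Re(a) - t; the other root becomes
2Re(d) + t. -/
theorem sym_left {t : ℝ} (ht : t ^ 2 - 2 * (a.re - d.re) * t + ‖c - star b‖ ^ 2 = 0) :
    (sym !![a, b; c, d]).mulVec ![star (c - star b), (t : ℍ[ℝ])] =
      ![star (c - star b), (t : ℍ[ℝ])] <• ((2 * a.re - t : ℝ) : ℍ[ℝ]) := by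
  rw [sym_mulVec_smul_eq_iff]
  simp only [Matrix.cons_val_zero, Matrix.cons_val_one]
  rw [sub_sub_cancel, mul_star_eq, ← Quaternion.coe_mul]
  exact ⟨Quaternion.coe_commutes _ _, congrArg _ (by linarith)⟩

theorem sym_right {t : ℝ} (ht : t ^ 2 - 2 * (a.re - d.re) * t + ‖c - star b‖ ^ 2 = 0) :
    (sym !![a, b; c, d]).mulVec ![(t : ℍ[ℝ]), c - star b] =
      ![(t : ℍ[ℝ]), c - star b] <• ((2 * d.re + t : ℝ) : ℍ[ℝ]) := by
  rw [sym_mulVec_smul_eq_iff]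
  simp only [Matrix.cons_val_zero, Matrix.cons_val_one]
  rw [add_sub_cancel_left, star_mul_eq, ← Quaternion.coe_mul]
  exact ⟨congrArg _ (by linarith), (Quaternion.coe_commutes _ _).symm⟩

theorem sym_mulVec_of_sym (hP : !![a, b; c, d] ∈ Sp11) {X : Vec} {u : ℍ[ℝ]}
    (h : (sym !![a, b; c, d]).mulVec X = X <• u) :
    (sym !![a, b; c, d]).mulVec ((!![a, b; c, d]).mulVec X) = (!![a, b; c, d]).mulVec X <• u := by
  rw [sym_comm hP, h, Matrix.mulVec_smul]

end Entries

/-! ### The types according to the sign of the discriminant. -/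

section Cases

variable {a b c d : ℍ[ℝ]}

theorem isElliptic_of_pos (hP : !![a, b; c, d] ∈ Sp11)
    (h : ‖c - star b‖ ^ 2 < (a.re - d.re) ^ 2) :
    IsElliptic ⟨!![a, b; c, d], hP⟩ ∧ |a.re + d.re| ≤ 2 ∧
      4 * |a.re + d.re| - 2 ≤ 2 + ‖c - star b‖ ^ 2 + 4 * a.re * d.re := by
  -- The roots have product |g|², so the one of larger modulus satisfies t² > |g|². It makes (ḡ, t)
  -- negative and (t, g) positive.
  obtain ⟨t, ht, htn⟩ : ∃ t : ℝ, t ^ 2 - 2 * (a.re - d.re) * t + ‖c - star b‖ ^ 2 = 0 ∧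
      ‖c - star b‖ ^ 2 < t ^ 2 := by
    have hs := Real.sq_sqrt (sub_pos.2 h).le
    have hs0 := Real.sqrt_nonneg ((a.re - d.re) ^ 2 - ‖c - star b‖ ^ 2)
    set s := √((a.re - d.re) ^ 2 - ‖c - star b‖ ^ 2)
    rcases le_total 0 (a.re - d.re) with he | he
    · exact ⟨a.re - d.re + s, by linear_combination hs, by nlinarith [mul_nonneg he hs0]⟩
    · exact ⟨a.re - d.re - s, by linear_combination hs,
        by nlinarith [mul_nonneg (neg_nonneg.2 he) hs0]⟩
  have ht0 : t ≠ 0 := by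
    rintro rfl
    nlinarith [sq_nonneg ‖c - star b‖]
  have hX : (form ![star (c - star b), (t : ℍ[ℝ])] ![star (c - star b), (t : ℍ[ℝ])]).re < 0 := by
    rw [form_self_re]
    simp only [Matrix.cons_val_zero, Matrix.cons_val_one, norm_star, Quaternion.norm_coe,
      Real.norm_eq_abs, sq_abs]
    linarith
  have hY : 0 < (form ![(t : ℍ[ℝ]), c - star b] ![(t : ℍ[ℝ]), c - star b]).re := by
    rw [form_self_re]
    simp only [Matrix.cons_val_zero, Matrix.cons_val_one, Quaternion.norm_coe,
      Real.norm_eq_abs, sq_abs]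
    linarith
  have hY0 : ![(t : ℍ[ℝ]), c - star b] ≠ 0 := by
    intro h0
    rw [h0] at hY
    simp [form_self_re] at hY
  obtain ⟨q, hq⟩ := sym_kernel_left ht0 (sym_mulVec_of_sym hP (sym_left ht))
  obtain ⟨q', hq'⟩ := sym_kernel_right ht0 (sym_mulVec_of_sym hP (sym_right ht))
  have hu := abs_le.1 (abs_le_two_of_sym_eigen hP hq (ne_zero_of_form_neg hX)
    (norm_eigenvalue hP hq hX.ne) (sym_left ht))
  have hu' := abs_le.1 (abs_le_two_of_sym_eigen hP hq' hY0
    (norm_eigenvalue hP hq' hY.ne') (sym_right ht))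
  refine ⟨isElliptic_of_eigen ⟨_, hP⟩ hX hq, abs_le.2 ⟨by linarith, by linarith⟩, ?_⟩
  rcases abs_cases (a.re + d.re) with ⟨h0, -⟩ | ⟨h0, -⟩ <;> rw [h0]
  -- With u, u' the eigenvalues of S, (2 - u)(2 - u') = ρ + 2 - 4τ.
  · nlinarith [mul_nonneg (sub_nonneg.2 hu.2) (sub_nonneg.2 hu'.2)]
  · nlinarith [mul_nonneg (sub_nonneg.2 hu.1) (sub_nonneg.2 hu'.1)]

theorem isParabolic_of_nilpotent (hP : !![a, b; c, d] ∈ Sp11)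
    (h : ‖c - star b‖ ^ 2 = (a.re - d.re) ^ 2) (he : a.re - d.re ≠ 0) :
    IsParabolic ⟨!![a, b; c, d], hP⟩ ∧ |a.re + d.re| ≤ 2 := by
  set t := a.re - d.re with ht_def
  have ht : t ^ 2 - 2 * (a.re - d.re) * t + ‖c - star b‖ ^ 2 = 0 := by
    rw [h, ← ht_def]; ring
  have hτ : 2 * a.re - t = a.re + d.re := by rw [ht_def]; ring
  obtain ⟨q, hq⟩ := sym_kernel_left he (sym_mulVec_of_sym hP (sym_left ht))
  have hXs := sym_left ht
  rw [hτ] at hXs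
  have ht' : (t : ℍ[ℝ]) ≠ 0 := by rwa [← Quaternion.coe_zero, ne_eq, Quaternion.coe_inj]
  have hX0 : ![star (c - star b), (t : ℍ[ℝ])] ≠ 0 := fun h0 => ht' (congrFun h0 1)
  have hXX : form ![star (c - star b), (t : ℍ[ℝ])] ![star (c - star b), (t : ℍ[ℝ])] = 0 := by
    rw [form_self_eq_zero_iff, form_self_re]
    simp only [Matrix.cons_val_zero, Matrix.cons_val_one, norm_star, Quaternion.norm_coe,
      Real.norm_eq_abs, sq_abs]
    linarith
  have hker : ∀ Z : Vec, (sym !![a, b; c, d]).mulVec Z = Z <• ((a.re + d.re : ℝ) : ℍ[ℝ]) →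
      ∃ q : ℍ[ℝ], Z = ![star (c - star b), (t : ℍ[ℝ])] <• q := by
    intro Z hZ
    rw [← hτ] at hZ
    exact sym_kernel_left he hZ
  have hY1 : (sym !![a, b; c, d]).mulVec ![0, 1] =
      ![0, 1] <• ((a.re + d.re : ℝ) : ℍ[ℝ]) - ![star (c - star b), (t : ℍ[ℝ])] := by
    rw [sym_eq, mulVec_vec, smul_vec_eq]
    apply vec_ext
    · simp
    · simp [ht_def]
      rw [← Quaternion.coe_mul, two_mul, Quaternion.coe_add]
  have hYX : form ![0, 1] ![star (c - star b), (t : ℍ[ℝ])] = -(t : ℍ[ℝ]) := by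
    rw [form_eq]; simp
  generalize hXdef : ![star (c - star b), (t : ℍ[ℝ])] = X at *
  generalize hYdef : (![0, 1] : Vec) = Y at *
  refine ⟨isParabolic_of_eigen ⟨_, hP⟩ hX0 hXX hq fun Z s hZ hs => hker Z ?_, ?_⟩
  · have hs0 := eigenvalue_ne_zero hP hZ hs
    have hZs := sym_mulVec_eigen hP hs0 hs
    have h2 := sym_sym a b c d Z
    rw [hZs, Matrix.mulVec_smul, hZs, smul_smul_right, smul_smul_right] at h2
    have h3 : (s + s⁻¹) * (s + s⁻¹) = (s + s⁻¹) * ((2 * (a.re + d.re) : ℝ) : ℍ[ℝ]) -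
        ((4 * a.re * d.re + ‖c - star b‖ ^ 2 : ℝ) : ℍ[ℝ]) := by
      apply smul_injective_right hZ
      rw [h2, MulOpposite.op_sub, sub_smul]
    have e1 : ((2 * (a.re + d.re) : ℝ) : ℍ[ℝ]) =
        ((a.re + d.re : ℝ) : ℍ[ℝ]) + ((a.re + d.re : ℝ) : ℍ[ℝ]) := by
      rw [← Quaternion.coe_add]; ring_nf
    have e2 : ((4 * a.re * d.re + ‖c - star b‖ ^ 2 : ℝ) : ℍ[ℝ]) =
        ((a.re + d.re : ℝ) : ℍ[ℝ]) * ((a.re + d.re : ℝ) : ℍ[ℝ]) := by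
      rw [← Quaternion.coe_mul, h, ht_def]; ring_nf
    have h4 : (s + s⁻¹ - ((a.re + d.re : ℝ) : ℍ[ℝ])) * (s + s⁻¹ - ((a.re + d.re : ℝ) : ℍ[ℝ])) = 0
      := by
      have hc := Quaternion.coe_commutes (a.re + d.re) (s + s⁻¹)
      rw [e1, e2] at h3
      rw [mul_sub, sub_mul, sub_mul, h3, hc]
      noncomm_ring
    rw [hZs, sub_eq_zero.1 (mul_self_eq_zero.1 h4)]
  -- The eigenvector X is isotropic, so |q| = 1 needs another argument: PY = Yq + Xs, and comparing
  -- ⟨PY, PX⟩ with ⟨Y, X⟩ = -t ≠ 0 gives |q|² = 1.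
  · have hPY : (sym !![a, b; c, d]).mulVec ((!![a, b; c, d]).mulVec Y - Y <• q) =
        ((!![a, b; c, d]).mulVec Y - Y <• q) <• ((a.re + d.re : ℝ) : ℍ[ℝ]) := by
      rw [Matrix.mulVec_sub, sym_comm hP, Matrix.mulVec_smul, hY1, Matrix.mulVec_sub, hq,
        Matrix.mulVec_smul, smul_sub, smul_sub, smul_smul_right, smul_smul_right,
        Quaternion.coe_commutes]
      abel
    obtain ⟨s, hs⟩ := hker _ hPY
    rw [sub_eq_iff_eq_add'] at hs
    have h1 := hP Y X
    rw [hs, hq, form_add_left, form_smul_left, form_smul_left, form_smul_right, form_smul_right,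
      hXX, zero_mul, mul_zero, add_zero, hYX] at h1
    have h2 := congrArg norm h1
    rw [norm_mul, norm_mul, norm_star, norm_neg, mul_comm, mul_assoc] at h2
    have h3 : ‖q‖ * ‖q‖ = 1 :=
      mul_left_cancel₀ (norm_ne_zero_iff.2 ht') (by rw [h2, mul_one])
    rw [← sq, pow_eq_one_iff_of_nonneg (norm_nonneg q) two_ne_zero] at h3
    exact abs_le_two_of_sym_eigen hP hq hX0 h3 hXs

theorem sym_scalar (hb : c = star b) (he : a.re = d.re) (Z : Vec) :
    (sym !![a, b; c, d]).mulVec Z = Z <• ((a.re + d.re : ℝ) : ℍ[ℝ]) := by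
  rw [sym_mulVec_smul_eq_iff, hb, he]
  have : 2 * d.re - (d.re + d.re) = 0 := by ring
  have h' : d.re + d.re - 2 * d.re = 0 := by ring
  simp [this, h']

theorem isElliptic_of_scalar (hP : !![a, b; c, d] ∈ Sp11) (hb : c = star b) (he : a.re = d.re)
    (h : |a.re + d.re| < 2) : IsElliptic ⟨!![a, b; c, d], hP⟩ := by
  rw [← he, ← two_mul, abs_mul, abs_two] at h
  have h1 : a.re ^ 2 < 1 := by
    rw [sq_lt_one_iff_abs_lt_one]; linarith
  -- The vector (b, d - r̄) used below has ⟨X, X⟩ = -2s² - 2s·d.imI; this choice of sign makes it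
  -- negative.
  obtain ⟨s, hs, hsd⟩ : ∃ s : ℝ, s ^ 2 = 1 - a.re ^ 2 ∧ 0 ≤ s * d.imI := by
    have hs := Real.sq_sqrt (sub_pos.2 h1).le
    rcases le_total 0 d.imI with hd | hd
    · exact ⟨_, hs, mul_nonneg (Real.sqrt_nonneg _) hd⟩
    · exact ⟨-√(1 - a.re ^ 2), by rw [neg_sq, hs],
        mul_nonneg_of_nonpos_of_nonpos (neg_nonpos.2 (Real.sqrt_nonneg _)) hd⟩
  let r : ℍ[ℝ] := ofReIm a.re s
  have hr1 : ‖r‖ = 1 := by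
    rw [← pow_eq_one_iff_of_nonneg (norm_nonneg r) two_ne_zero, sq,
      ← Quaternion.normSq_eq_norm_mul_self, Quaternion.normSq_def']
    simp only [r, re_ofReIm, imI_ofReIm, imJ_ofReIm, imK_ofReIm]
    linarith
  have hr0 : r ≠ 0 := by rw [← norm_ne_zero_iff, hr1]; exact one_ne_zero
  have hr : r + r⁻¹ = ((a.re + d.re : ℝ) : ℍ[ℝ]) := by
    rw [add_inv_eq_re hr1, ← he, two_mul, re_ofReIm]
  refine isElliptic_of_eigen ⟨_, hP⟩ ?_ (eigen_of_sym hP hr0 hr (sym_scalar hb he ![0, 1]))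
  have hd := (norm_sq_sub_of_mem hP).2
  rw [form_self_re, inv_eq_star hr1, mulVec_vec, smul_vec_eq]
  simp only [Pi.sub_apply, Matrix.cons_val_zero, Matrix.cons_val_one, mul_zero, zero_mul, zero_add,
    mul_one, one_mul, sub_zero]
  have e1 : ‖d - star r‖ ^ 2 = (d.re - a.re) ^ 2 + (d.imI + s) ^ 2 + d.imJ ^ 2 + d.imK ^ 2 := by
    rw [sq, ← Quaternion.normSq_eq_norm_mul_self, Quaternion.normSq_def']
    simp [r]
  have e2 : ‖d‖ ^ 2 = d.re ^ 2 + d.imI ^ 2 + d.imJ ^ 2 + d.imK ^ 2 := by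
    rw [sq, ← Quaternion.normSq_eq_norm_mul_self, Quaternion.normSq_def']
  rw [e1]
  rw [e2] at hd
  nlinarith

theorem isParabolic_of_scalar (hP : !![a, b; c, d] ∈ Sp11) (hb : c = star b) (he : a.re = d.re)
    (h : a.re ^ 2 = 1) (hne : !![a, b; c, d] ≠ ((a.re : ℍ[ℝ]) • (1 : Matrix (Fin 2) (Fin 2) ℍ[ℝ])))
      :
    IsParabolic ⟨!![a, b; c, d], hP⟩ := by
  set k := a.re
  have hk : (k : ℍ[ℝ]) * k = 1 := by rw [← Quaternion.coe_mul, ← sq, h, Quaternion.coe_one]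
  have hk0 : (k : ℍ[ℝ]) ≠ 0 := left_ne_zero_of_mul_eq_one hk
  have hki : (k : ℍ[ℝ])⁻¹ = k := inv_eq_of_mul_eq_one_right hk
  obtain ⟨hac, hdb⟩ := norm_sq_sub_of_mem hP
  have norm_sub : ∀ q : ℍ[ℝ], q.re = k → ‖q - k‖ ^ 2 = ‖q‖ ^ 2 - 1 := by
    intro q hq
    rw [sq, sq, ← Quaternion.normSq_eq_norm_mul_self, ← Quaternion.normSq_eq_norm_mul_self,
      Quaternion.normSq_def', Quaternion.normSq_def']
    simp only [Quaternion.re_sub, Quaternion.imI_sub, Quaternion.imJ_sub, Quaternion.imK_sub,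
      Quaternion.re_coe, Quaternion.imI_coe, Quaternion.imJ_coe, Quaternion.imK_coe, hq]
    linear_combination -h
  have hna := norm_sub a rfl
  have hnd := norm_sub d he.symm
  have hbc : ‖c‖ = ‖b‖ := by rw [hb, norm_star]
  have hc0 : c ≠ 0 := by
    rintro rfl
    rw [norm_zero] at hbc
    have h1 : a - k = 0 := by
      rw [← norm_eq_zero, ← sq_eq_zero_iff, hna, ← hac]; simp
    have h2 : d - k = 0 := by
      rw [← norm_eq_zero, ← sq_eq_zero_iff, hnd, ← hdb, ← hbc]; simp
    have h3 : b = 0 := norm_eq_zero.1 hbc.symm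
    apply hne
    rw [sub_eq_zero.1 h1, sub_eq_zero.1 h2, h3]
    ext1 i j
    fin_cases i <;> fin_cases j <;> simp
  have ha0 : a - k ≠ 0 := by
    intro h0
    rw [h0, norm_zero] at hna
    have : ‖c‖ ^ 2 = 0 := by linarith
    exact hc0 (norm_eq_zero.1 (sq_eq_zero_iff.1 this))
  -- Here (P - k)² = 0, and (a - k, c) is the image of the first basis vector under P - k.
  have hX : (!![a, b; c, d]).mulVec ![a - k, c] = ![a - k, c] <• (k : ℍ[ℝ]) := by
    have h1 := eigen_of_sym hP hk0 (u := ((k + d.re : ℝ) : ℍ[ℝ]))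
      (by rw [hki, ← he, Quaternion.coe_add]) (sym_scalar hb he ![1, 0])
    have h2 : (!![a, b; c, d]).mulVec ![1, 0] - ![1, 0] <• (k : ℍ[ℝ])⁻¹ = ![a - k, c] := by
      rw [hki, mulVec_vec, smul_vec_eq]
      apply vec_ext <;> simp
    rwa [h2] at h1
  refine isParabolic_of_eigen ⟨_, hP⟩ (X := ![a - k, c]) (fun h0 => hc0 (congrFun h0 1)) ?_ hX ?_
  · rw [form_self_eq_zero_iff, form_self_re]
    simp only [Matrix.cons_val_zero, Matrix.cons_val_one]
    linarith
  · intro Z s hZ hs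
    have hs0 := eigenvalue_ne_zero hP hZ hs
    have h1 := sym_mulVec_eigen hP hs0 hs
    rw [sym_scalar hb he] at h1
    have h2 := smul_injective_right hZ h1
    rw [← he, Quaternion.coe_add] at h2
    have h3 : (s - k) * (s - k) = 0 := by
      have h4 : ((k : ℍ[ℝ]) + k) * s = (s + s⁻¹) * s := by rw [h2]
      rw [add_mul s, inv_mul_cancel₀ hs0] at h4
      have h5 := Quaternion.coe_commutes k s
      linear_combination (norm := noncomm_ring) hk - h4 + h5
    have h4 : s = k := sub_eq_zero.1 (mul_self_eq_zero.1 h3)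
    rw [h4] at hs
    have hXe := ((mulVec_eq_smul_iff _ _ _ _ _ _).1 hX).1
    have hZe := ((mulVec_eq_smul_iff _ _ _ _ _ _).1 hs).1
    rw [← Quaternion.coe_commutes] at hXe hZe
    simp only [Matrix.cons_val_zero, Matrix.cons_val_one] at hXe
    refine ⟨c⁻¹ * Z 1, ?_⟩
    rw [smul_vec_eq]
    apply vec_ext
    · simp only [Matrix.cons_val_zero]
      apply mul_left_cancel₀ ha0
      have hc1 : c * c⁻¹ = 1 := mul_inv_cancel₀ hc0
      linear_combination (norm := noncomm_ring) hZe - hXe * c⁻¹ * Z 1 + b * hc1 * Z 1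
    · simp [mul_inv_cancel_left₀ hc0]

theorem isLoxodromic_of_scalar (hP : !![a, b; c, d] ∈ Sp11) (hb : c = star b) (he : a.re = d.re)
    (h : 2 < |a.re + d.re|) : IsLoxodromic ⟨!![a, b; c, d], hP⟩ := by
  obtain ⟨r, hr0, hr, hr1⟩ := exists_add_inv_eq (a.re + d.re) 0 (Or.inr h)
  have hs : ∀ Z : Vec, (sym !![a, b; c, d]).mulVec Z =
      Z <• ofReIm (a.re + d.re) 0 := sym_scalar hb he
  refine isLoxodromic_of_nondegenerate hP hr0 hr hr1
    ⟨![1, 0], fun h0 => one_ne_zero (congrFun h0 0), hs _⟩ fun X hX _ => ?_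
  obtain ⟨Y, hY⟩ := exists_form_eq hX 1
  exact ⟨Y, hs Y, by rw [hY]; exact one_ne_zero⟩

theorem isLoxodromic_of_neg (hP : !![a, b; c, d] ∈ Sp11)
    (h : (a.re - d.re) ^ 2 < ‖c - star b‖ ^ 2) : IsLoxodromic ⟨!![a, b; c, d], hP⟩ := by
  obtain ⟨s, hs0, hs⟩ : ∃ s : ℝ, 0 < s ∧ s ^ 2 = ‖c - star b‖ ^ 2 - (a.re - d.re) ^ 2 :=
    ⟨√(‖c - star b‖ ^ 2 - (a.re - d.re) ^ 2), Real.sqrt_pos.2 (sub_pos.2 h),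
      Real.sq_sqrt (sub_pos.2 h).le⟩
  obtain ⟨r, hr0, hr, hr1⟩ := exists_add_inv_eq (a.re + d.re) s (Or.inl hs0.ne')
  set τ := a.re + d.re with hτ
  -- With λ = τ + si, this vector is (SZ - Zλ̄)(-i): up to a right scalar, the projection to the
  -- solutions of SX = Xλ.
  have hproj : ∀ Z : Vec, (sym !![a, b; c, d]).mulVec
      (Z <• ofReIm s τ - (sym !![a, b; c, d]).mulVec Z <• ofReIm 0 1) =
      (Z <• ofReIm s τ - (sym !![a, b; c, d]).mulVec Z <• ofReIm 0 1) <•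
        ofReIm τ s := by
    intro Z
    rw [Matrix.mulVec_sub, Matrix.mulVec_smul, Matrix.mulVec_smul, sym_sym, ← hτ, smul_sub,
      smul_sub, smul_smul_right, smul_smul_right, smul_smul_right, smul_smul_right]
    have e1 : ofReIm s τ - ((2 * τ : ℝ) : ℍ[ℝ]) * ofReIm 0 1 =
        -(ofReIm 0 1 * ofReIm τ s) := by
      ext <;> simp
      ring
    obtain ⟨m, hm⟩ : ∃ m, 4 * a.re * d.re + ‖c - star b‖ ^ 2 = m := ⟨_, rfl⟩
    have hm' : m = τ ^ 2 + s ^ 2 := by rw [← hm, hs, hτ]; ring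
    rw [hm]
    have e2 : ofReIm s τ * ofReIm τ s = (m : ℍ[ℝ]) * ofReIm 0 1 := by
      ext <;> simp
      · ring
      · rw [hm']; ring
    rw [e2]
    have e3 := congrArg (fun q => (sym !![a, b; c, d]).mulVec Z <• q) e1
    simp only [MulOpposite.op_sub, MulOpposite.op_neg, sub_smul, neg_smul] at e3
    rw [sub_eq_iff_eq_add] at e3
    rw [e3]
    abel
  refine isLoxodromic_of_nondegenerate hP hr0 hr hr1 ⟨_, ?_, hproj ![1, 0]⟩ fun X hX hXs => ?_
  · intro h0
    have h1 := congrFun h0 1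
    rw [sym_eq, mulVec_vec, smul_vec_eq, smul_vec_eq] at h1
    simp only [Pi.sub_apply, Matrix.cons_val_zero, Matrix.cons_val_one, mul_zero, zero_mul,
      add_zero,
      mul_one, zero_sub, Pi.zero_apply, neg_eq_zero] at h1
    rcases mul_eq_zero.1 h1 with h2 | h2
    · rw [h2, norm_zero] at h
      nlinarith [sq_nonneg (a.re - d.re)]
    · simpa using congrArg (·.imI) h2
  -- Take w = j: the pairing below becomes 2sj, whereas any complex w would give 0.
  · obtain ⟨w, hw₀, hw₁, hw₂, hw₃⟩ : ∃ w : ℍ[ℝ], w.re = 0 ∧ w.imI = 0 ∧ w.imJ = 1 ∧ w.imK = 0 :=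
      ⟨⟨0, 0, 1, 0⟩, rfl, rfl, rfl, rfl⟩
    obtain ⟨Z, hZ⟩ := exists_form_eq hX w
    refine ⟨_, hproj Z, ?_⟩
    rw [form_sub_right, form_smul_right, form_smul_right, ← form_sym, hXs, form_smul_left, hZ]
    intro h0
    have h1 := congrArg (·.imJ) h0
    simp [hw₀, hw₁, hw₂, hw₃] at h1
    linarith

end Cases

end QuatHyp

end

/-! ### The classification by regions. -/

theorem theorem1 (a b c d : ℍ[ℝ]) (hP : !![a, b; c, d] ∈ QuatHyp.Sp11)
    (hI : !![a, b; c, d] ≠ (1 : Matrix (Fin 2) (Fin 2) ℍ[ℝ]))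
    (hnI : !![a, b; c, d] ≠ (-1 : Matrix (Fin 2) (Fin 2) ℍ[ℝ]))
    (τ ρ : ℝ) (hτ : τ = (a + d).re)
    (hρ : ρ = 2 + ‖c - star b‖ ^ 2 + 4 * a.re * d.re) :
    (QuatHyp.IsElliptic ⟨!![a, b; c, d], hP⟩ ↔
      (τ, ρ) ∈ QuatHyp.R₁ \ (QuatHyp.R₁ ∩ QuatHyp.R₂) ∨
      ((τ, ρ) ∈ (QuatHyp.R₁ ∩ QuatHyp.R₂) \ {((2 : ℝ), (6 : ℝ)), ((-2 : ℝ), (6 : ℝ))} ∧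
        a.re = d.re ∧ c = star b)) ∧
    (QuatHyp.IsParabolic ⟨!![a, b; c, d], hP⟩ ↔
      ((τ, ρ) = (2, 6) ∨ (τ, ρ) = (-2, 6)) ∨
      ((τ, ρ) ∈ (QuatHyp.R₁ ∩ QuatHyp.R₂) \ {((2 : ℝ), (6 : ℝ)), ((-2 : ℝ), (6 : ℝ))} ∧
        (a.re ≠ d.re ∨ c ≠ star b))) ∧
    (QuatHyp.IsLoxodromic ⟨!![a, b; c, d], hP⟩ ↔
      (τ, ρ) ∈ QuatHyp.R₂ \ (QuatHyp.R₁ ∩ QuatHyp.R₂)) := by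
  rw [Quaternion.re_add] at hτ
  have hEP := fun h : QuatHyp.IsElliptic ⟨!![a, b; c, d], hP⟩ => h.not_isParabolic
  have hEL := fun h : QuatHyp.IsElliptic ⟨!![a, b; c, d], hP⟩ => h.not_isLoxodromic
  have hPL := fun h : QuatHyp.IsParabolic ⟨!![a, b; c, d], hP⟩ => h.not_isLoxodromic
  have hD : τ ^ 2 + 2 - ρ = (a.re - d.re) ^ 2 - ‖c - star b‖ ^ 2 := by rw [hτ, hρ]; ring
  have hpt : (τ, ρ) ∈ ({((2 : ℝ), (6 : ℝ)), ((-2 : ℝ), (6 : ℝ))} : Set (ℝ × ℝ)) ↔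
      |τ| = 2 ∧ ρ = 6 := by
    rw [abs_eq zero_le_two, or_and_right]
    simp [Prod.ext_iff]
  have hpt' : ((τ, ρ) = (2, 6) ∨ (τ, ρ) = (-2, 6)) ↔ |τ| = 2 ∧ ρ = 6 := hpt
  have hR₁ : (τ, ρ) ∈ QuatHyp.R₁ ↔ |τ| ≤ 2 ∧ 4 * |τ| - 2 ≤ ρ ∧ ρ ≤ τ ^ 2 + 2 := Iff.rfl
  have hR₂ : (τ, ρ) ∈ QuatHyp.R₂ ↔ τ ^ 2 + 2 ≤ ρ := Iff.rfl
  simp only [Set.mem_sdiff, Set.mem_inter_iff]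
  rw [hpt, hpt', hR₁, hR₂]
  -- The parabola lies above the two lines since (|τ| - 2)² ≥ 0.
  have hsq : 4 * |τ| - 2 ≤ τ ^ 2 + 2 := by nlinarith [sq_nonneg (|τ| - 2), sq_abs τ]
  rcases lt_trichotomy (‖c - star b‖ ^ 2) ((a.re - d.re) ^ 2) with h | h | h
  · obtain ⟨hE, h1, h2⟩ := QuatHyp.isElliptic_of_pos hP h
    rw [← hτ] at h1 h2
    rw [← hρ] at h2
    have h3 : ρ < τ ^ 2 + 2 := by linarith
    have h4 : ¬ (|τ| = 2 ∧ ρ = 6) := by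
      rintro ⟨h5, h6⟩
      rw [← sq_abs, h5] at h3
      linarith
    simp only [eq_true hE, eq_false (hEP hE), eq_false (hEL hE), eq_true h1, eq_true h2, eq_true
      h3.le, eq_false h3.not_ge, eq_false h4]
    simp
  · have hρτ : ρ = τ ^ 2 + 2 := by linarith
    have h6 : |τ| = 2 → ρ = 6 := by
      intro h6
      rw [hρτ, ← sq_abs, h6]; norm_num
    have hle : ρ ≤ τ ^ 2 + 2 := hρτ.le
    have hge : τ ^ 2 + 2 ≤ ρ := hρτ.ge
    rw [← hρτ] at hsq
    by_cases he : a.re = d.re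
    · have hb : c = star b := by
        rw [he, sub_self] at h
        have h0 : ‖c - star b‖ = 0 := by simpa using h
        exact sub_eq_zero.1 (norm_eq_zero.1 h0)
      rcases lt_trichotomy |τ| 2 with h1 | h1 | h1
      · have hE := QuatHyp.isElliptic_of_scalar hP hb he (hτ ▸ h1)
        simp only [eq_true hE, eq_false (hEP hE), eq_false (hEL hE), eq_true h1.le, eq_false h1.ne,
          eq_true hsq, eq_true hle, eq_true hge, eq_true he, eq_true hb]
        simp
        exact ⟨he, hb⟩
      · have hk : a.re ^ 2 = 1 := by
          rw [hτ, ← he, ← two_mul, abs_mul, abs_two] at h1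
          rw [← sq_abs, show |a.re| = 1 by linarith, one_pow]
        have hPa := QuatHyp.isParabolic_of_scalar hP hb he hk (by
          rcases (by simpa using hk : a.re = 1 ∨ a.re = -1) with h0 | h0
          · simpa [h0] using hI
          · simpa [h0] using hnI)
        simp only [eq_false (fun h => hEP h hPa), eq_true hPa, eq_false (hPL hPa), eq_true h1.le,
          eq_true h1, eq_true (h6 h1), eq_true hsq, eq_true hle, eq_true hge, eq_true he, eq_true
          hb]
        simp
      · have hL := QuatHyp.isLoxodromic_of_scalar hP hb he (hτ ▸ h1)
        simp only [eq_false (fun h => hEL h hL), eq_false (fun h => hPL h hL), eq_true hL, eq_false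
          h1.not_ge, eq_false h1.ne', eq_true hsq, eq_true hle, eq_true hge, eq_true he, eq_true hb]
        simp
    · obtain ⟨hPa, h1⟩ := QuatHyp.isParabolic_of_nilpotent hP h (sub_ne_zero.2 he)
      rw [← hτ] at h1
      simp only [eq_false (fun h => hEP h hPa), eq_true hPa, eq_false (hPL hPa), eq_true h1,
        eq_true hsq, eq_true hle, eq_true hge, eq_false he]
      by_cases h4 : |τ| = 2 ∧ ρ = 6
      · simp only [eq_true h4]
        simp
      · simp only [eq_false h4]
        simp
        exact Or.inl he
  · have hL := QuatHyp.isLoxodromic_of_neg hP h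
    have h3 : τ ^ 2 + 2 < ρ := by linarith
    have h4 : ¬ (|τ| = 2 ∧ ρ = 6) := by
      rintro ⟨h5, h6⟩
      rw [← sq_abs, h5] at h3
      linarith
    simp only [eq_false (fun h => hEL h hL), eq_false (fun h => hPL h hL), eq_true hL, eq_false
      h3.not_ge, eq_true h3.le, eq_false h4]
    simp
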